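/- **Proposition 4.1 (Heisenberg group).** Let $H_3$ be the Heisenberg group, that is, $\mathbb R^3$ with the multiplication $$(x',y',z')\cdot(x,y,z)=\bigl(x'+x,\;y'+y,\;z'+z+\tfrac12 yx'-\tfrac12 y'x\bigr),$$ and let $g$ be the left-invariant Riemannian metric on $H_3$ for which the left-invariant frame $$e_1=\frac{\partial}{\partial x}-\frac y2\frac{\partial}{\partial z},\qquad e_2=\frac{\partial}{\partial y}+\frac x2\frac{\partial}{\partial z},\qquad e_3=\frac{\partial}{\partial z}$$ is orthonormal. Let $X\neq 0$ be a left-invariant vector field on $H_3$ with $g(X,X)<1$, let $F=\alpha+\beta$ with $\alpha(p,v)=\sqrt{g_p(v,v)}$ and $\beta(p,v)=g_p(X_p,v)$ be the left-invariant Randers metric defined by $g$ and $X$, let $f:H_3\to\mathbb R$ be smooth, and let $\tilde F=e^fF$. Then $\tilde F$ is a Douglas metric if and only if there are $a,b\in\mathbb R$ such that $$X=ae_1+be_2,\qquad \frac{\partial f}{\partial z}=0,\qquad b\,\frac{\partial f}{\partial x}-a\,\frac{\partial f}{\partial y}=0$$ on all of $H_3$. Here a Finsler metric $\tilde F$ on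 $\mathbb R^n$ is called a Douglas metric if its spray coefficients $$G^i=\tfrac14\,g^{il}\Bigl(\frac{\partial^2\tilde F^2}{\partial x^k\partial y^l}\,y^k-\frac{\partial \tilde F^2}{\partial x^l}\Bigr),\qquad (g^{il})=(g_{il})^{-1},\quad g_{il}=\tfrac12\frac{\partial^2\tilde F^2}{\partial y^i\partial y^l},$$ have the form $G^i=\tfrac12\Gamma^i_{jk}(x)y^jy^k+P(x,y)\,y^i$ for all $x$ and all $y\neq0$, with functions $\Gamma^i_{jk}$ of $x$ alone and a function $P$ that is positively homogeneous of degree one in $y$. -/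

import Mathlib

open scoped ContDiff

noncomputable section

/-! Finsler geometry on the open coordinate chart `ℝⁿ`. A function `F x y` depends on a base point
`x` and on a tangent vector `y` at `x`, given by its components in the standard coordinates. -/

namespace FinslerChart

variable {n : ℕ}

/-- The partial derivative `∂u/∂xⁱ` at `x`. -/
def partialDeriv (i : Fin n) (u : (Fin n → ℝ) → ℝ) (x : Fin n → ℝ) : ℝ :=
  fderiv ℝ u x (Pi.single i 1)

/-- The fundamental tensor `g_ij(x, y) = ½ ∂²(F²)/∂yⁱ∂yʲ`. -/
def fundamentalTensor (F : (Fin n → ℝ) → (Fin n → ℝ) → ℝ) (x y : Fin n → ℝ) :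
    Matrix (Fin n) (Fin n) ℝ :=
  Matrix.of fun i j =>
    (1 / 2 : ℝ) * partialDeriv i (fun v => partialDeriv j (fun w => F x w ^ 2) v) y

/-- Finsler metrics: smooth off the zero section, positive, positively homogeneous of degree one
and strongly convex. -/
structure IsFinslerMetric (F : (Fin n → ℝ) → (Fin n → ℝ) → ℝ) : Prop where
  smooth : ContDiffOn ℝ ∞ (fun q : (Fin n → ℝ) × (Fin n → ℝ) => F q.1 q.2) {q | q.2 ≠ 0}
  pos : ∀ x y, y ≠ 0 → 0 < F x y
  homogeneous : ∀ x y (t : ℝ), 0 < t → F x (t • y) = t * F x y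
  convex : ∀ x y, y ≠ 0 → ∀ w : Fin n → ℝ, w ≠ 0 →
    0 < ∑ i, ∑ j, fundamentalTensor F x y i j * w i * w j

/-- The spray (geodesic) coefficients
`Gⁱ = ¼ gⁱˡ ( ∂²(F²)/∂xᵏ∂yˡ yᵏ - ∂(F²)/∂xˡ )`. -/
def sprayCoeff (F : (Fin n → ℝ) → (Fin n → ℝ) → ℝ) (x y : Fin n → ℝ) (i : Fin n) : ℝ :=
  (1 / 4 : ℝ) * ∑ l, (fundamentalTensor F x y)⁻¹ i l *
    ((∑ k, partialDeriv k (fun p => partialDeriv l (fun v => F p v ^ 2) y) x * y k)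
      - partialDeriv l (fun p => F p y ^ 2) x)

/-- Douglas metrics: Finsler metrics whose spray coefficients have the form
`Gⁱ = ½ Γⁱ_jk(x) yʲ yᵏ + P(x, y) yⁱ` with `P` positively homogeneous of degree one in `y`. -/
structure IsDouglasMetric (F : (Fin n → ℝ) → (Fin n → ℝ) → ℝ) : Prop where
  finsler : IsFinslerMetric F
  spray : ∃ (Γ : (Fin n → ℝ) → Fin n → Fin n → Fin n → ℝ)
      (P : (Fin n → ℝ) → (Fin n → ℝ) → ℝ),
    (∀ x y (t : ℝ), 0 < t → P x (t • y) = t * P x y) ∧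
    ∀ x y, y ≠ 0 → ∀ i, sprayCoeff F x y i =
      (1 / 2 : ℝ) * (∑ j, ∑ k, Γ x i j k * y j * y k) + P x y * y i

/-- The function `α + β`, where `α(x, y) = √(g_x(y, y))` and `β` is the 1-form `g(X, ·)`. -/
def randers (g : (Fin n → ℝ) → (Fin n → ℝ) → (Fin n → ℝ) → ℝ) (X : (Fin n → ℝ) → (Fin n → ℝ))
    (x y : Fin n → ℝ) : ℝ :=
  Real.sqrt (g x y y) + g x (X x) y

/-- The conformal change `e^f F`. -/
def conformal (f : (Fin n → ℝ) → ℝ) (F : (Fin n → ℝ) → (Fin n → ℝ) → ℝ)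
    (x y : Fin n → ℝ) : ℝ :=
  Real.exp (f x) * F x y

end FinslerChart

/-! The Heisenberg group: `ℝ³` with coordinates `x = p 0`, `y = p 1`, `z = p 2`. -/

namespace Heisenberg

/-- The multiplication of the Heisenberg group. -/
def mul (p q : Fin 3 → ℝ) : Fin 3 → ℝ :=
  ![p 0 + q 0, p 1 + q 1, p 2 + q 2 + (1 / 2) * q 1 * p 0 - (1 / 2) * p 1 * q 0]

/-- The Heisenberg group structure on `ℝ³`. -/
@[reducible] def group : Group (Fin 3 → ℝ) :=
  @Group.ofLeftAxioms (Fin 3 → ℝ) ⟨mul⟩ ⟨fun p => -p⟩ ⟨0⟩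
    (fun p q r => by
      change mul (mul p q) r = mul p (mul q r)
      ext i
      fin_cases i <;> simp [mul] <;> ring)
    (fun p => by
      change mul 0 p = p
      ext i
      fin_cases i <;> simp [mul])
    (fun p => by
      change mul (-p) p = 0
      ext i
      fin_cases i <;> simp [mul])

/-- Left-invariant vector fields: `(dL_p)_q (X q) = X (p q)`. -/
def IsLeftInvariant (X : (Fin 3 → ℝ) → (Fin 3 → ℝ)) : Prop :=
  ∀ p q, fderiv ℝ (mul p) q (X q) = X (mul p q)

/-- The frame `e₁ = ∂x - (y/2) ∂z`, `e₂ = ∂y + (x/2) ∂z`, `e₃ = ∂z`. -/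
def frame : Fin 3 → (Fin 3 → ℝ) → (Fin 3 → ℝ) :=
  ![fun p => ![1, 0, -(p 1) / 2], fun p => ![0, 1, p 0 / 2], fun _ => ![0, 0, 1]]

/-- The Riemannian metric `dx² + dy² + (dz + (y/2) dx - (x/2) dy)²`. -/
def metric (p u v : Fin 3 → ℝ) : ℝ :=
  u 0 * v 0 + u 1 * v 1 +
    (u 2 + p 1 / 2 * u 0 - p 0 / 2 * u 1) * (v 2 + p 1 / 2 * v 0 - p 0 / 2 * v 1)

/-- The frame is orthonormal for the metric. -/
theorem metric_frame (p : Fin 3 → ℝ) (i j : Fin 3) :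
    metric p (frame i p) (frame j p) = if i = j then 1 else 0 := by
  fin_cases i <;> fin_cases j <;> simp [metric, frame] <;> ring

theorem fderiv_mul (p q v : Fin 3 → ℝ) :
    fderiv ℝ (mul p) q v =
      ![v 0, v 1, v 2 + (1 / 2) * v 1 * p 0 - (1 / 2) * p 1 * v 0] := by
  have h : HasFDerivAt (mul p)
      (ContinuousLinearMap.pi ![ContinuousLinearMap.proj 0, ContinuousLinearMap.proj 1,
        ContinuousLinearMap.proj 2 + (p 0 / 2) • ContinuousLinearMap.proj 1
          - (p 1 / 2) • ContinuousLinearMap.proj 0] : (Fin 3 → ℝ) →L[ℝ] (Fin 3 → ℝ)) q := by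
    rw [hasFDerivAt_pi']
    have h0 := hasFDerivAt_apply (𝕜 := ℝ) (0 : Fin 3) q
    have h1 := hasFDerivAt_apply (𝕜 := ℝ) (1 : Fin 3) q
    have h2 := hasFDerivAt_apply (𝕜 := ℝ) (2 : Fin 3) q
    intro i
    fin_cases i
    · exact h0.const_add (p 0)
    · exact h1.const_add (p 1)
    · have := (((h2.add (h1.const_mul (p 0 / 2))).sub (h0.const_mul (p 1 / 2))).const_add (p 2))
      refine this.congr_of_eventuallyEq (Filter.Eventually.of_forall fun r => ?_)
      simp [mul]
      ring
  rw [h.fderiv]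
  ext i
  fin_cases i <;> simp
  ring

theorem frame_isLeftInvariant (i : Fin 3) : IsLeftInvariant (frame i) := by
  intro p q
  rw [fderiv_mul]
  ext k
  fin_cases i <;> fin_cases k <;> simp [frame, mul] <;> ring

/-- The metric is left-invariant. -/
theorem metric_mul (p q u v : Fin 3 → ℝ) :
    metric (mul p q) (fderiv ℝ (mul p) q u) (fderiv ℝ (mul p) q v) = metric q u v := by
  rw [fderiv_mul, fderiv_mul]
  simp [metric, mul]
  ring

end Heisenberg

end

open FinslerChart

open scoped ContDiff
open FinslerChart

namespace FinslerChart

variable {n : ℕ}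

/-! ### Calculus of partial derivatives -/

/-! Write `F̃ = α̃ + β̃`, where `α̃ = e^f α` is the norm of the Riemannian metric `e^{2f} g` and `β̃
= e^f g(X, ·)` is a one-form. The claim splits into a general fact, that `α̃ + β̃` is Douglas if and
only if `dβ̃ = 0`, and the computation of when `β̃` is closed.

For the general fact, let `E_l(F) = F_{x^k y^l} y^k - F_{x^l}`. Since `g_li = F_l F_i + F F_li`
(indices on `F` are `y`-derivatives), Euler's identities split the spray equation: its contraction
with `y` determines `P`, and what remains is `E_l(F) = F_{y^l y^i} Γ^i_jk y^j y^k`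
(`isDouglasMetric_iff`). Adding a one-form `b` keeps the vertical Hessian and adds `(∂_k b_l - ∂_l
b_k) y^k` to `E_l`. For reversible `α` all other terms are even in `y`, while this one is odd, so it
must vanish; conversely, if it vanishes, the `Γ` of `α` still serves
(`IsDouglasMetric.add_oneForm_iff`). Riemannian norms are reversible and Douglas.

On the Heisenberg group `g(X, ·)` is a form `ω` with constant coefficients `c` in the left-invariant
coframe, and `dω = -c₂ dx ∧ dy`. Closedness of `e^f ω` means `df ∧ ω + dω = 0`. Wedging with `ω`
gives `c₂² = 0`, and the components of `df ∧ ω = 0` are then the stated equations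
(`closed_exp_mul_iff`). -/

theorem fderiv_eq_sum_partialDeriv (u : (Fin n → ℝ) → ℝ) (x w : Fin n → ℝ) :
    fderiv ℝ u x w = ∑ i, partialDeriv i u x * w i := by
  conv_lhs => rw [← Finset.univ_sum_single w]
  rw [map_sum]
  refine Finset.sum_congr rfl fun i _ => ?_
  rw [partialDeriv, mul_comm, ← smul_eq_mul, ← map_smul, ← Pi.single_smul, smul_eq_mul, mul_one]

theorem partialDeriv_congr {i : Fin n} {u v : (Fin n → ℝ) → ℝ} {x : Fin n → ℝ}
    (h : u =ᶠ[nhds x] v) : partialDeriv i u x = partialDeriv i v x := by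
  rw [partialDeriv, partialDeriv, h.fderiv_eq]

theorem partialDeriv_add {i : Fin n} {u v : (Fin n → ℝ) → ℝ} {x : Fin n → ℝ}
    (hu : DifferentiableAt ℝ u x) (hv : DifferentiableAt ℝ v x) :
    partialDeriv i (fun p => u p + v p) x = partialDeriv i u x + partialDeriv i v x := by
  simp [partialDeriv, fderiv_fun_add hu hv]

theorem partialDeriv_mul {i : Fin n} {u v : (Fin n → ℝ) → ℝ} {x : Fin n → ℝ}
    (hu : DifferentiableAt ℝ u x) (hv : DifferentiableAt ℝ v x) :
    partialDeriv i (fun p => u p * v p) x = u x * partialDeriv i v x + partialDeriv i u x * v x := by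
  simp [partialDeriv, fderiv_fun_mul hu hv, mul_comm]

theorem partialDeriv_const_mul {i : Fin n} {u : (Fin n → ℝ) → ℝ} {x : Fin n → ℝ} (c : ℝ)
    (hu : DifferentiableAt ℝ u x) :
    partialDeriv i (fun p => c * u p) x = c * partialDeriv i u x := by
  simp [partialDeriv, fderiv_const_mul hu]

theorem partialDeriv_sum {ι : Type*} {i : Fin n} (s : Finset ι) {u : ι → (Fin n → ℝ) → ℝ}
    {x : Fin n → ℝ} (hu : ∀ k ∈ s, DifferentiableAt ℝ (u k) x) :
    partialDeriv i (fun p => ∑ k ∈ s, u k p) x = ∑ k ∈ s, partialDeriv i (u k) x := by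
  simp [partialDeriv, fderiv_fun_sum hu]

theorem partialDeriv_const (i : Fin n) (c : ℝ) (x : Fin n → ℝ) :
    partialDeriv i (fun _ => c) x = 0 := by
  simp [partialDeriv]

theorem partialDeriv_apply (i j : Fin n) (x : Fin n → ℝ) :
    partialDeriv i (fun p => p j) x = if i = j then 1 else 0 := by
  rw [partialDeriv, (hasFDerivAt_apply (𝕜 := ℝ) j x).fderiv]
  simp [Pi.single_apply, eq_comm]

theorem partialDeriv_linear (i : Fin n) (c x : Fin n → ℝ) :
    partialDeriv i (fun p => ∑ k, c k * p k) x = c i := by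
  rw [partialDeriv_sum _ fun k _ => by fun_prop]
  simp [partialDeriv_const_mul _ (differentiableAt_apply _ _), partialDeriv_apply]

theorem partialDeriv_sq {i : Fin n} {u : (Fin n → ℝ) → ℝ} {x : Fin n → ℝ}
    (hu : DifferentiableAt ℝ u x) :
    partialDeriv i (fun p => u p ^ 2) x = 2 * u x * partialDeriv i u x := by
  simp only [pow_two]
  rw [partialDeriv_mul hu hu]
  ring

theorem partialDeriv_comp_smul (i : Fin n) (u : (Fin n → ℝ) → ℝ) (t : ℝ)
    {x : Fin n → ℝ} (hu : DifferentiableAt ℝ u (t • x)) :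
    partialDeriv i (fun p => u (t • p)) x = t * partialDeriv i u (t • x) := by
  have h : HasFDerivAt (fun p : Fin n → ℝ => t • p)
      (t • ContinuousLinearMap.id ℝ (Fin n → ℝ)) x := (hasFDerivAt_id x).const_smul t
  have := (hu.hasFDerivAt.comp x h).fderiv
  simp only [Function.comp_def] at this
  simp [partialDeriv, this]

/-! ### Euler's identities -/

/-- Differentiate `t ↦ u (t • y)` at `t = 1`. Leaving `φ` free covers degrees one and zero at once.
-/
theorem fderiv_apply_self_of_homogeneous {u : (Fin n → ℝ) → ℝ} {y : Fin n → ℝ} {φ : ℝ → ℝ}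
    {φ' : ℝ} (hu : DifferentiableAt ℝ u y) (h : ∀ t : ℝ, 0 < t → u (t • y) = φ t)
    (hφ : HasDerivAt φ φ' 1) : ∑ i, partialDeriv i u y * y i = φ' := by
  rw [← fderiv_eq_sum_partialDeriv]
  have h1 : HasDerivAt (fun t : ℝ => t • y) y 1 := by
    simpa using (hasDerivAt_id (1 : ℝ)).smul_const y
  have h2 : HasDerivAt (fun t : ℝ => u (t • y)) (fderiv ℝ u y y) 1 := by
    have hu' : HasFDerivAt u (fderiv ℝ u y) ((1 : ℝ) • y) := by simpa using hu.hasFDerivAt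
    exact hu'.comp_hasDerivAt 1 h1
  refine (h2.congr_of_eventuallyEq ?_).unique hφ
  filter_upwards [lt_mem_nhds zero_lt_one] with t ht using (h t ht).symm

theorem euler_one {u : (Fin n → ℝ) → ℝ} {y : Fin n → ℝ} (hu : DifferentiableAt ℝ u y)
    (h : ∀ t : ℝ, 0 < t → u (t • y) = t * u y) : ∑ i, partialDeriv i u y * y i = u y :=
  fderiv_apply_self_of_homogeneous hu h (by simpa using (hasDerivAt_id (1 : ℝ)).mul_const (u y))

theorem euler_zero {u : (Fin n → ℝ) → ℝ} {y : Fin n → ℝ} (hu : DifferentiableAt ℝ u y)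
    (h : ∀ t : ℝ, 0 < t → u (t • y) = u y) : ∑ i, partialDeriv i u y * y i = 0 :=
  fderiv_apply_self_of_homogeneous hu h (hasDerivAt_const _ _)

/-! ### Functions smooth off the zero section -/

/-- Smoothness of a function of base point and tangent vector, off the zero section. -/
def SmoothOffZero (F : (Fin n → ℝ) → (Fin n → ℝ) → ℝ) : Prop :=
  ContDiffOn ℝ ∞ (fun q : (Fin n → ℝ) × (Fin n → ℝ) => F q.1 q.2) {q | q.2 ≠ 0}

theorem isOpen_offZero : IsOpen {q : (Fin n → ℝ) × (Fin n → ℝ) | q.2 ≠ 0} :=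
  isOpen_ne_fun continuous_snd continuous_const

/-- The vertical partial derivative. -/
noncomputable def vertDeriv (i : Fin n) (F : (Fin n → ℝ) → (Fin n → ℝ) → ℝ) (x y : Fin n → ℝ) : ℝ :=
  partialDeriv i (F x) y

/-- The horizontal partial derivative, in the coordinate direction. -/
noncomputable def horDeriv (i : Fin n) (F : (Fin n → ℝ) → (Fin n → ℝ) → ℝ) (x y : Fin n → ℝ) : ℝ :=
  partialDeriv i (fun p => F p y) x

namespace SmoothOffZero

variable {F H : (Fin n → ℝ) → (Fin n → ℝ) → ℝ}

theorem contDiffAt (hF : SmoothOffZero F) (x : Fin n → ℝ) {y : Fin n → ℝ} (hy : y ≠ 0) :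
    ContDiffAt ℝ ∞ (fun q : (Fin n → ℝ) × (Fin n → ℝ) => F q.1 q.2) (x, y) :=
  ContDiffOn.contDiffAt hF (isOpen_offZero.mem_nhds hy)

theorem contDiffAt_vert (hF : SmoothOffZero F) (x : Fin n → ℝ) {y : Fin n → ℝ} (hy : y ≠ 0) :
    ContDiffAt ℝ ∞ (F x) y :=
  (hF.contDiffAt x hy).comp (f := fun v => (x, v)) y (by fun_prop)

theorem contDiffAt_hor (hF : SmoothOffZero F) (x : Fin n → ℝ) {y : Fin n → ℝ} (hy : y ≠ 0) :
    ContDiffAt ℝ ∞ (fun p => F p y) x :=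
  (hF.contDiffAt x hy).comp (f := fun p => (p, y)) x (by fun_prop)

theorem differentiableAt_vert (hF : SmoothOffZero F) (x : Fin n → ℝ) {y : Fin n → ℝ}
    (hy : y ≠ 0) : DifferentiableAt ℝ (F x) y :=
  (hF.contDiffAt_vert x hy).differentiableAt (by simp)

theorem differentiableAt_hor (hF : SmoothOffZero F) (x : Fin n → ℝ) {y : Fin n → ℝ}
    (hy : y ≠ 0) : DifferentiableAt ℝ (fun p => F p y) x :=
  (hF.contDiffAt_hor x hy).differentiableAt (by simp)

theorem add (hF : SmoothOffZero F) (hH : SmoothOffZero H) :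
    SmoothOffZero (fun x y => F x y + H x y) :=
  ContDiffOn.add hF hH

/-- The vertical derivative is the derivative of the joint function in the direction `(0, e_i)`,
hence jointly smooth. -/
theorem vertDeriv (hF : SmoothOffZero F) (i : Fin n) : SmoothOffZero (vertDeriv i F) := by
  have h : ContDiffOn ℝ ∞ (fun q : (Fin n → ℝ) × (Fin n → ℝ) =>
      fderiv ℝ (fun q : (Fin n → ℝ) × (Fin n → ℝ) => F q.1 q.2) q (0, Pi.single i 1))
      {q | q.2 ≠ 0} :=
    (ContDiffOn.fderiv_of_isOpen hF isOpen_offZero (by simp)).clm_apply contDiffOn_const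
  refine h.congr fun q hq => ?_
  have h1 : HasFDerivAt (fun v : Fin n → ℝ => (q.1, v))
      (ContinuousLinearMap.inr ℝ (Fin n → ℝ) (Fin n → ℝ)) q.2 := hasFDerivAt_prodMk_right _ _
  have h2 := ((hF.contDiffAt q.1 hq).differentiableAt (by simp)).hasFDerivAt
  have h3 := (h2.comp q.2 h1).fderiv
  simp only [Function.comp_def] at h3
  simp [FinslerChart.vertDeriv, partialDeriv, h3]

end SmoothOffZero

theorem vertDeriv_neg (i : Fin n) {F : (Fin n → ℝ) → (Fin n → ℝ) → ℝ} {x y : Fin n → ℝ} {c : ℝ}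
    (hF : DifferentiableAt ℝ (F x) (-y)) (h : ∀ v, F x (-v) = c * F x v) (hc : c * c = 1) :
    vertDeriv i F x (-y) = -c * vertDeriv i F x y := by
  have h0 : (-1 : ℝ) • y = -y := by simp
  have hd : DifferentiableAt ℝ (F x) y := by
    have : DifferentiableAt ℝ (fun v => c * F x (-v)) y := by
      refine DifferentiableAt.const_mul ?_ c
      exact DifferentiableAt.comp (g := F x) (f := fun v => -v) y hF (by fun_prop)
    refine this.congr_of_eventuallyEq (Filter.Eventually.of_forall fun v => ?_)
    simp only
    rw [h, ← mul_assoc, hc, one_mul]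
  have h1 := partialDeriv_comp_smul i (F x) (-1) (x := y) (by rwa [h0])
  simp only [neg_smul, one_smul, h] at h1
  rw [partialDeriv_const_mul c hd] at h1
  simp only [vertDeriv]
  linarith

theorem vertDeriv_smul (i : Fin n) {F : (Fin n → ℝ) → (Fin n → ℝ) → ℝ} {x y : Fin n → ℝ}
    {t c : ℝ} (ht : t ≠ 0) (hF : DifferentiableAt ℝ (F x) (t • y))
    (hd : DifferentiableAt ℝ (F x) y) (h : ∀ v, F x (t • v) = c * F x v) :
    vertDeriv i F x (t • y) = c / t * vertDeriv i F x y := by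
  have h1 := partialDeriv_comp_smul i (F x) t (x := y) hF
  simp only [h] at h1
  rw [partialDeriv_const_mul c hd] at h1
  simp only [vertDeriv]
  field_simp
  linarith

/-! ### Fundamental tensor and Euler–Lagrange covector in terms of `F` itself -/

theorem fundamentalTensor_eq {F : (Fin n → ℝ) → (Fin n → ℝ) → ℝ} (hF : SmoothOffZero F)
    (x : Fin n → ℝ) {y : Fin n → ℝ} (hy : y ≠ 0) (i j : Fin n) :
    fundamentalTensor F x y i j = vertDeriv i F x y * vertDeriv j F x y
      + F x y * vertDeriv i (vertDeriv j F) x y := by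
  have h : (fun v => partialDeriv j (fun w => F x w ^ 2) v) =ᶠ[nhds y]
      fun v => 2 * (F x v * vertDeriv j F x v) := by
    filter_upwards [isOpen_ne.mem_nhds hy] with v hv
    rw [partialDeriv_sq (hF.differentiableAt_vert x hv), vertDeriv, mul_assoc]
  have h1 := hF.differentiableAt_vert x hy
  have h2 := (hF.vertDeriv j).differentiableAt_vert x hy
  rw [fundamentalTensor, Matrix.of_apply, partialDeriv_congr h,
    partialDeriv_const_mul _ (h1.fun_mul h2), partialDeriv_mul h1 h2]
  simp only [vertDeriv]
  ring

/-- The Euler–Lagrange covector of `F ^ 2`, whose contraction with the inverse of the fundamental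
tensor gives the spray. -/
theorem sprayCovector_eq {F : (Fin n → ℝ) → (Fin n → ℝ) → ℝ} (hF : SmoothOffZero F)
    (x : Fin n → ℝ) {y : Fin n → ℝ} (hy : y ≠ 0) (l : Fin n) :
    (∑ k, partialDeriv k (fun p => partialDeriv l (fun v => F p v ^ 2) y) x * y k)
      - partialDeriv l (fun p => F p y ^ 2) x =
    2 * vertDeriv l F x y * (∑ k, horDeriv k F x y * y k)
      + 2 * F x y * ((∑ k, horDeriv k (vertDeriv l F) x y * y k) - horDeriv l F x y) := by
  have h1 := hF.differentiableAt_hor x hy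
  have h2 := (hF.vertDeriv l).differentiableAt_hor x hy
  have h : (fun p => partialDeriv l (fun v => F p v ^ 2) y) =
      fun p => 2 * (F p y * vertDeriv l F p y) := by
    funext p
    rw [partialDeriv_sq (hF.differentiableAt_vert p hy), vertDeriv, mul_assoc]
  have h3 : ∀ k, partialDeriv k (fun p => partialDeriv l (fun v => F p v ^ 2) y) x * y k =
      2 * vertDeriv l F x y * (horDeriv k F x y * y k)
      + 2 * F x y * (horDeriv k (vertDeriv l F) x y * y k) := by
    intro k
    rw [h, partialDeriv_const_mul _ (h1.fun_mul h2), partialDeriv_mul h1 h2]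
    simp only [horDeriv]
    ring
  rw [partialDeriv_sq h1, Finset.sum_congr rfl fun k _ => h3 k, Finset.sum_add_distrib,
    ← Finset.mul_sum, ← Finset.mul_sum]
  simp only [horDeriv]
  ring

end FinslerChart

namespace FinslerChart

variable {n : ℕ} {F : (Fin n → ℝ) → (Fin n → ℝ) → ℝ}

/-! ### Finsler metrics -/

namespace IsFinslerMetric

theorem smoothOffZero (hF : IsFinslerMetric F) : SmoothOffZero F := hF.smooth

theorem sum_vertDeriv (hF : IsFinslerMetric F) (x : Fin n → ℝ) {y : Fin n → ℝ} (hy : y ≠ 0) :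
    ∑ i, vertDeriv i F x y * y i = F x y :=
  euler_one (hF.smoothOffZero.differentiableAt_vert x hy) (hF.homogeneous x y)

theorem vertDeriv_smul (hF : IsFinslerMetric F) (i : Fin n) (x : Fin n → ℝ) {y : Fin n → ℝ}
    (hy : y ≠ 0) {t : ℝ} (ht : 0 < t) : vertDeriv i F x (t • y) = vertDeriv i F x y := by
  rw [FinslerChart.vertDeriv_smul i ht.ne'
    (hF.smoothOffZero.differentiableAt_vert x (smul_ne_zero ht.ne' hy))
    (hF.smoothOffZero.differentiableAt_vert x hy) fun v => hF.homogeneous x v t ht,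
    div_self ht.ne', one_mul]

theorem sum_vertDeriv_vertDeriv (hF : IsFinslerMetric F) (l : Fin n) (x : Fin n → ℝ)
    {y : Fin n → ℝ} (hy : y ≠ 0) : ∑ i, vertDeriv i (vertDeriv l F) x y * y i = 0 :=
  euler_zero ((hF.smoothOffZero.vertDeriv l).differentiableAt_vert x hy)
    fun _ ht => hF.vertDeriv_smul l x hy ht

/-- Differentiate Euler's identity `F_l y^l = F` in `y^i`. Contracting the inner index this way
avoids the symmetry of second derivatives. -/
theorem sum_vertDeriv_vertDeriv' (hF : IsFinslerMetric F) (i : Fin n) (x : Fin n → ℝ)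
    {y : Fin n → ℝ} (hy : y ≠ 0) : ∑ l, vertDeriv i (vertDeriv l F) x y * y l = 0 := by
  have h : (fun v => ∑ l, vertDeriv l F x v * v l) =ᶠ[nhds y] F x := by
    filter_upwards [isOpen_ne.mem_nhds hy] with v hv using hF.sum_vertDeriv x hv
  have hd := fun l => (hF.smoothOffZero.vertDeriv l).differentiableAt_vert x hy
  have h1 := partialDeriv_congr (i := i) h
  rw [partialDeriv_sum _ fun l _ => (hd l).fun_mul (differentiableAt_apply l y),
    Finset.sum_congr rfl fun l _ => partialDeriv_mul (hd l) (differentiableAt_apply l y),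
    Finset.sum_add_distrib] at h1
  simpa [partialDeriv_apply, vertDeriv] using h1

/-- This is Euler's identity differentiated in the base point; it makes the Euler–Lagrange covector
vanish on `y`. -/
theorem sum_horDeriv_vertDeriv (hF : IsFinslerMetric F) (k : Fin n) (x : Fin n → ℝ)
    {y : Fin n → ℝ} (hy : y ≠ 0) :
    ∑ l, horDeriv k (vertDeriv l F) x y * y l = horDeriv k F x y := by
  have h : (fun p => ∑ l, y l * vertDeriv l F p y) = fun p => F p y := by
    funext p
    simpa only [mul_comm] using hF.sum_vertDeriv p hy
  have hd := fun l => (hF.smoothOffZero.vertDeriv l).differentiableAt_hor x hy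
  have h1 : partialDeriv k (fun p => ∑ l, y l * vertDeriv l F p y) x = horDeriv k F x y := by
    rw [h, horDeriv]
  rw [partialDeriv_sum _ fun l _ => (hd l).const_mul (y l)] at h1
  rw [← h1]
  refine Finset.sum_congr rfl fun l _ => ?_
  rw [partialDeriv_const_mul _ (hd l), mul_comm, horDeriv]

/-! ### The spray equation and the Douglas condition without the inverse tensor -/

theorem isUnit_det (hF : IsFinslerMetric F) (x : Fin n → ℝ) {y : Fin n → ℝ} (hy : y ≠ 0) :
    IsUnit (fundamentalTensor F x y).det := by
  rw [isUnit_iff_ne_zero]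
  intro h
  obtain ⟨w, hw, h0⟩ := Matrix.exists_mulVec_eq_zero_iff.mpr h
  have h1 := hF.convex x y hy w hw
  have h2 : ∑ i, ∑ j, fundamentalTensor F x y i j * w i * w j =
      w ⬝ᵥ (fundamentalTensor F x y).mulVec w := by
    simp only [dotProduct, Matrix.mulVec, Finset.mul_sum]
    exact Finset.sum_congr rfl fun i _ => Finset.sum_congr rfl fun j _ => by ring
  rw [h2, h0, dotProduct_zero] at h1
  exact lt_irrefl _ h1

theorem sprayCoeff_eq_iff (hF : IsFinslerMetric F) (x : Fin n → ℝ) {y : Fin n → ℝ}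
    (hy : y ≠ 0) (G : Fin n → ℝ) :
    (∀ i, sprayCoeff F x y i = G i) ↔ ∀ l, 4 * ∑ i, fundamentalTensor F x y l i * G i =
      (∑ k, partialDeriv k (fun p => partialDeriv l (fun v => F p v ^ 2) y) x * y k)
        - partialDeriv l (fun p => F p y ^ 2) x := by
  set r : Fin n → ℝ := fun l =>
    (∑ k, partialDeriv k (fun p => partialDeriv l (fun v => F p v ^ 2) y) x * y k)
        - partialDeriv l (fun p => F p y ^ 2) x with hr
  have hu := hF.isUnit_det x hy
  set g := fundamentalTensor F x y with hg
  have h1 : ∀ i, sprayCoeff F x y i = ((1 / 4 : ℝ) • g⁻¹.mulVec r) i := fun i => by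
    simp [sprayCoeff, Matrix.mulVec, dotProduct, hr, hg]
  have h2 : ∀ l, 4 * ∑ i, g l i * G i = ((4 : ℝ) • g.mulVec G) l := fun l => by
    simp [Matrix.mulVec, dotProduct]
  simp only [h1, h2]
  change (∀ i, _ = G i) ↔ ∀ l, _ = r l
  rw [← funext_iff, ← funext_iff]
  constructor
  · rintro rfl
    rw [Matrix.mulVec_smul, smul_smul, Matrix.mulVec_mulVec, Matrix.mul_nonsing_inv _ hu]
    norm_num
  · intro h
    rw [← h, Matrix.mulVec_smul, smul_smul, Matrix.mulVec_mulVec, Matrix.nonsing_inv_mul _ hu]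
    norm_num

/-- The spray of `F` at `y` is `q / 2 + P y` if and only if the Euler–Lagrange covector of `F` is
the contraction of the vertical Hessian of `F` with `q`, and `P` is the corresponding projective
factor. -/
theorem sprayCoeff_eq_add_iff (hF : IsFinslerMetric F) (x : Fin n → ℝ) {y : Fin n → ℝ}
    (hy : y ≠ 0) (q : Fin n → ℝ) (P : ℝ) :
    (∀ i, sprayCoeff F x y i = 1 / 2 * q i + P * y i) ↔
      (∀ l, (∑ k, horDeriv k (vertDeriv l F) x y * y k) - horDeriv l F x y =
        ∑ i, vertDeriv l (vertDeriv i F) x y * q i) ∧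
      2 * P * F x y = (∑ k, horDeriv k F x y * y k) - ∑ i, vertDeriv i F x y * q i := by
  have hpos := hF.pos x y hy
  have e1 := hF.sum_vertDeriv x hy
  rw [hF.sprayCoeff_eq_iff x hy]
  have key : ∀ l, 4 * ∑ i, fundamentalTensor F x y l i * (1 / 2 * q i + P * y i) =
      2 * vertDeriv l F x y * (∑ i, vertDeriv i F x y * q i) + 4 * vertDeriv l F x y * P * F x y
      + 2 * F x y * ∑ i, vertDeriv l (vertDeriv i F) x y * q i := by
    intro l
    have e2 := hF.sum_vertDeriv_vertDeriv' l x hy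
    have h1 : ∀ i, fundamentalTensor F x y l i * (1 / 2 * q i + P * y i) =
        1 / 2 * vertDeriv l F x y * (vertDeriv i F x y * q i)
        + vertDeriv l F x y * P * (vertDeriv i F x y * y i)
        + 1 / 2 * F x y * (vertDeriv l (vertDeriv i F) x y * q i)
        + F x y * P * (vertDeriv l (vertDeriv i F) x y * y i) := by
      intro i
      rw [fundamentalTensor_eq hF.smoothOffZero x hy]
      ring
    simp only [h1, Finset.sum_add_distrib, ← Finset.mul_sum, e1, e2]
    ring
  simp only [key, sprayCovector_eq hF.smoothOffZero x hy]
  set S := ∑ i, vertDeriv i F x y * q i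
  set T := ∑ k, horDeriv k F x y * y k with hT
  constructor
  · intro h
    -- Contract the equation with `y^l`: the Hessian term and the Euler–Lagrange covector both
    -- vanish on `y`, and `F_l y^l = F ≠ 0` can be cancelled.
    have hB : 2 * P * F x y = T - S := by
      have h1 : ∑ l, (∑ i, vertDeriv l (vertDeriv i F) x y * q i) * y l = 0 := by
        simp only [Finset.sum_mul]
        rw [Finset.sum_comm]
        refine Finset.sum_eq_zero fun i _ => ?_
        rw [← mul_zero (q i), ← hF.sum_vertDeriv_vertDeriv i x hy, Finset.mul_sum]
        exact Finset.sum_congr rfl fun l _ => by ring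
      have h2 : ∑ l, ((∑ k, horDeriv k (vertDeriv l F) x y * y k) - horDeriv l F x y) * y l
          = 0 := by
        simp only [sub_mul, Finset.sum_sub_distrib, Finset.sum_mul]
        rw [Finset.sum_comm, sub_eq_zero]
        refine Finset.sum_congr rfl fun k _ => ?_
        rw [← hF.sum_horDeriv_vertDeriv k x hy, Finset.sum_mul]
        exact Finset.sum_congr rfl fun l _ => by ring
      have h3 : ∑ l, ((2 * (S + 2 * P * F x y - T)) * (vertDeriv l F x y * y l)
          + 2 * F x y * ((∑ i, vertDeriv l (vertDeriv i F) x y * q i) * y l)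
          - 2 * F x y * (((∑ k, horDeriv k (vertDeriv l F) x y * y k) - horDeriv l F x y)
            * y l)) = 0 :=
        Finset.sum_eq_zero fun l _ => by linear_combination y l * h l
      rw [Finset.sum_sub_distrib, Finset.sum_add_distrib, ← Finset.mul_sum, ← Finset.mul_sum,
        ← Finset.mul_sum, h1, h2, e1] at h3
      have h4 : (S + 2 * P * F x y - T) * F x y = 0 := by linarith
      rcases mul_eq_zero.mp h4 with h5 | h5
      · linarith
      · exact absurd h5 hpos.ne'
    refine ⟨fun l => ?_, hB⟩
    have h1 : 2 * F x y ≠ 0 := by positivity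
    refine mul_left_cancel₀ h1 ?_
    linear_combination 2 * vertDeriv l F x y * hB - h l
  · rintro ⟨h1, h2⟩ l
    rw [h1 l]
    linear_combination 2 * vertDeriv l F x y * h2

/-- The projective factor is no constraint: `2 P F = T - S` defines it, with `T - S` of degree two
and `F` of degree one in `y`, so `P` automatically has degree one. -/
theorem isDouglasMetric_iff (hF : IsFinslerMetric F) :
    IsDouglasMetric F ↔ ∃ Γ : (Fin n → ℝ) → Fin n → Fin n → Fin n → ℝ, ∀ x y, y ≠ 0 → ∀ l,
      (∑ k, horDeriv k (vertDeriv l F) x y * y k) - horDeriv l F x y =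
        ∑ i, vertDeriv l (vertDeriv i F) x y * ∑ j, ∑ k, Γ x i j k * y j * y k := by
  constructor
  · rintro ⟨-, Γ, P, -, h⟩
    exact ⟨Γ, fun x y hy => ((hF.sprayCoeff_eq_add_iff x hy _ _).mp (h x y hy)).1⟩
  · rintro ⟨Γ, h⟩
    refine ⟨hF, Γ, fun x y => ((∑ k, horDeriv k F x y * y k) -
      ∑ i, vertDeriv i F x y * ∑ j, ∑ k, Γ x i j k * y j * y k) / (2 * F x y), ?_, ?_⟩
    · intro x y t ht
      -- Homogeneity of `P` is required at `y = 0` too, where `F` need not be smooth; there the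
      -- numerator vanishes.
      rcases eq_or_ne y 0 with rfl | hy
      · simp
      have h1 : ∀ k, horDeriv k F x (t • y) = t * horDeriv k F x y := fun k => by
        simp only [horDeriv, hF.homogeneous _ y t ht]
        exact partialDeriv_const_mul t (hF.smoothOffZero.differentiableAt_hor x hy)
      have h2 : ∀ i, (∑ j, ∑ k, Γ x i j k * (t • y) j * (t • y) k) =
          t ^ 2 * ∑ j, ∑ k, Γ x i j k * y j * y k := fun i => by
        simp only [Finset.mul_sum, Pi.smul_apply, smul_eq_mul]
        exact Finset.sum_congr rfl fun j _ => Finset.sum_congr rfl fun k _ => by ring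
      have h3 : (∑ k, horDeriv k F x (t • y) * (t • y) k) =
          t ^ 2 * ∑ k, horDeriv k F x y * y k := by
        simp only [h1, Finset.mul_sum, Pi.smul_apply, smul_eq_mul]
        exact Finset.sum_congr rfl fun k _ => by ring
      have h4 : (∑ i, vertDeriv i F x (t • y) *
            ∑ j, ∑ k, Γ x i j k * (t • y) j * (t • y) k) =
          t ^ 2 * ∑ i, vertDeriv i F x y * ∑ j, ∑ k, Γ x i j k * y j * y k := by
        simp only [h2]
        rw [Finset.mul_sum]
        refine Finset.sum_congr rfl fun i _ => ?_
        rw [hF.vertDeriv_smul i x hy ht]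
        ring
      have hpos := hF.pos x y hy
      simp only [h3, h4, hF.homogeneous x y t ht]
      field_simp
    · intro x y hy
      have hpos := hF.pos x y hy
      refine (hF.sprayCoeff_eq_add_iff x hy _ _).mpr ⟨h x y hy, ?_⟩
      field_simp

end IsFinslerMetric

end FinslerChart

namespace FinslerChart

variable {n : ℕ} {α : (Fin n → ℝ) → (Fin n → ℝ) → ℝ} {b : Fin n → (Fin n → ℝ) → ℝ}

/-! ### Adding a one-form to a Finsler metric -/

/-- The one-form `∑ b_l dx^l`. -/
noncomputable def oneForm (b : Fin n → (Fin n → ℝ) → ℝ) (x y : Fin n → ℝ) : ℝ :=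
  ∑ l, b l x * y l

theorem smoothOffZero_oneForm (hb : ∀ l, ContDiff ℝ ∞ (b l)) : SmoothOffZero (oneForm b) := by
  refine ContDiff.contDiffOn (ContDiff.sum fun l _ => ?_)
  have := hb l
  fun_prop

theorem vertDeriv_oneForm (l : Fin n) : vertDeriv l (oneForm b) = fun x _ => b l x := by
  funext x y
  exact partialDeriv_linear l (fun l => b l x) y

theorem vertDeriv_add_oneForm (hα : SmoothOffZero α) (hb : ∀ l, ContDiff ℝ ∞ (b l)) (l : Fin n)
    (x : Fin n → ℝ) {y : Fin n → ℝ} (hy : y ≠ 0) :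
    vertDeriv l (fun x y => α x y + oneForm b x y) x y = vertDeriv l α x y + b l x := by
  rw [← congrFun (congrFun (vertDeriv_oneForm (b := b) l) x) y]
  exact partialDeriv_add (hα.differentiableAt_vert x hy)
    ((smoothOffZero_oneForm hb).differentiableAt_vert x hy)

theorem vertDeriv_vertDeriv_add_oneForm (hα : SmoothOffZero α) (hb : ∀ l, ContDiff ℝ ∞ (b l))
    (i l : Fin n) (x : Fin n → ℝ) {y : Fin n → ℝ} (hy : y ≠ 0) :
    vertDeriv i (vertDeriv l (fun x y => α x y + oneForm b x y)) x y =
      vertDeriv i (vertDeriv l α) x y := by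
  have h : vertDeriv l (fun x y => α x y + oneForm b x y) x =ᶠ[nhds y]
      fun v => vertDeriv l α x v + b l x := by
    filter_upwards [isOpen_ne.mem_nhds hy] with v hv using vertDeriv_add_oneForm hα hb l x hv
  rw [vertDeriv, partialDeriv_congr h, partialDeriv_add
    ((hα.vertDeriv l).differentiableAt_vert x hy) (differentiableAt_const _), partialDeriv_const,
    add_zero, vertDeriv]

theorem horDeriv_vertDeriv_add_oneForm (hα : SmoothOffZero α) (hb : ∀ l, ContDiff ℝ ∞ (b l))
    (k l : Fin n) (x : Fin n → ℝ) {y : Fin n → ℝ} (hy : y ≠ 0) :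
    horDeriv k (vertDeriv l (fun x y => α x y + oneForm b x y)) x y =
      horDeriv k (vertDeriv l α) x y + partialDeriv k (b l) x := by
  have h : (fun p => vertDeriv l (fun x y => α x y + oneForm b x y) p y) =
      fun p => vertDeriv l α p y + b l p :=
    funext fun p => vertDeriv_add_oneForm hα hb l p hy
  rw [horDeriv, h, partialDeriv_add ((hα.vertDeriv l).differentiableAt_hor x hy)
    ((hb l).differentiable (by simp)).differentiableAt, horDeriv]

theorem horDeriv_add_oneForm (hα : SmoothOffZero α) (hb : ∀ l, ContDiff ℝ ∞ (b l))
    (k : Fin n) (x : Fin n → ℝ) {y : Fin n → ℝ} (hy : y ≠ 0) :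
    horDeriv k (fun x y => α x y + oneForm b x y) x y =
      horDeriv k α x y + ∑ l, partialDeriv k (b l) x * y l := by
  have hd : ∀ l, DifferentiableAt ℝ (b l) x := fun l =>
    ((hb l).differentiable (by simp)).differentiableAt
  rw [horDeriv, partialDeriv_add (hα.differentiableAt_hor x hy)
    ((smoothOffZero_oneForm hb).differentiableAt_hor x hy), horDeriv]
  congr 1
  simp only [oneForm]
  rw [partialDeriv_sum _ fun l _ => (hd l).mul_const (y l)]
  refine Finset.sum_congr rfl fun l _ => ?_
  rw [partialDeriv_mul (hd l) (differentiableAt_const _), partialDeriv_const]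
  ring

/-! ### Strong convexity after adding a one-form -/

theorem sum_fundamentalTensor (hα : SmoothOffZero α) (x : Fin n → ℝ) {y : Fin n → ℝ}
    (hy : y ≠ 0) (w : Fin n → ℝ) :
    ∑ i, ∑ j, fundamentalTensor α x y i j * w i * w j = (∑ i, vertDeriv i α x y * w i) ^ 2
      + α x y * ∑ i, ∑ j, vertDeriv i (vertDeriv j α) x y * w i * w j := by
  rw [pow_two, Finset.sum_mul_sum]
  simp only [fundamentalTensor_eq hα x hy, Finset.mul_sum, ← Finset.sum_add_distrib]
  exact Finset.sum_congr rfl fun i _ => Finset.sum_congr rfl fun j _ => by ring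

namespace IsFinslerMetric

theorem sum_vertDeriv_vertDeriv_sub (hα : IsFinslerMetric α) (x : Fin n → ℝ) {y : Fin n → ℝ}
    (hy : y ≠ 0) (w : Fin n → ℝ) (s : ℝ) :
    ∑ i, ∑ j, vertDeriv i (vertDeriv j α) x y * (w - s • y) i * (w - s • y) j =
      ∑ i, ∑ j, vertDeriv i (vertDeriv j α) x y * w i * w j := by
  have h : ∀ i j, vertDeriv i (vertDeriv j α) x y * (w - s • y) i * (w - s • y) j =
      vertDeriv i (vertDeriv j α) x y * w i * w j
      - s * w j * (vertDeriv i (vertDeriv j α) x y * y i)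
      - s * (w - s • y) i * (vertDeriv i (vertDeriv j α) x y * y j) := fun i j => by
    simp only [Pi.sub_apply, Pi.smul_apply, smul_eq_mul]
    ring
  have h1 : ∑ i, ∑ j, s * w j * (vertDeriv i (vertDeriv j α) x y * y i) = 0 := by
    rw [Finset.sum_comm]
    refine Finset.sum_eq_zero fun j _ => ?_
    rw [← Finset.mul_sum, hα.sum_vertDeriv_vertDeriv j x hy, mul_zero]
  have h2 : ∑ i, ∑ j, s * (w - s • y) i * (vertDeriv i (vertDeriv j α) x y * y j) = 0 := by
    refine Finset.sum_eq_zero fun i _ => ?_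
    rw [← Finset.mul_sum, hα.sum_vertDeriv_vertDeriv' i x hy, mul_zero]
  simp only [h, Finset.sum_sub_distrib, h1, h2, sub_zero]

/-- The vertical Hessian of a Finsler metric is positive transversally to the radial direction. -/
theorem hessian_pos_or_radial (hα : IsFinslerMetric α) (x : Fin n → ℝ) {y : Fin n → ℝ}
    (hy : y ≠ 0) (w : Fin n → ℝ) :
    0 < ∑ i, ∑ j, vertDeriv i (vertDeriv j α) x y * w i * w j ∨ ∃ s : ℝ, w = s • y := by
  have hpos := hα.pos x y hy
  -- This `s` puts `w - s • y` in the kernel of the vertical differential of `α`, so that only the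
  -- Hessian term of the fundamental tensor survives.
  set s : ℝ := (∑ i, vertDeriv i α x y * w i) / α x y with hs
  rcases eq_or_ne (w - s • y) 0 with h | h
  · exact Or.inr ⟨s, sub_eq_zero.mp h⟩
  left
  have h1 := hα.convex x y hy _ h
  have h2 : ∑ i, vertDeriv i α x y * (w - s • y) i = 0 := by
    simp only [Pi.sub_apply, Pi.smul_apply, smul_eq_mul, mul_sub, Finset.sum_sub_distrib,
      mul_left_comm _ s, ← Finset.mul_sum, hα.sum_vertDeriv x hy]
    rw [hs, div_mul_cancel₀ _ hpos.ne', sub_self]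
  rw [sum_fundamentalTensor hα.smoothOffZero x hy, h2, hα.sum_vertDeriv_vertDeriv_sub x hy] at h1
  have h3 : 0 < α x y * ∑ i, ∑ j, vertDeriv i (vertDeriv j α) x y * w i * w j := by linarith
  exact (mul_pos_iff_of_pos_left hpos).mp h3

/-- The new fundamental form is a square plus the positive factor `α + β` times the old Hessian. For
non-radial `w` the Hessian term is positive; for `w = s • y` the square is `(s (α + β))²`. -/
theorem add_oneForm (hα : IsFinslerMetric α) (hb : ∀ l, ContDiff ℝ ∞ (b l))
    (hpos : ∀ x y, y ≠ 0 → 0 < α x y + oneForm b x y) :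
    IsFinslerMetric (fun x y => α x y + oneForm b x y) := by
  have hs : SmoothOffZero (fun x y => α x y + oneForm b x y) :=
    hα.smoothOffZero.add (smoothOffZero_oneForm hb)
  have hhom : ∀ x y (t : ℝ), 0 < t →
      α x (t • y) + oneForm b x (t • y) = t * (α x y + oneForm b x y) := by
    intro x y t ht
    rw [hα.homogeneous x y t ht, mul_add]
    congr 1
    simp only [oneForm, Finset.mul_sum, Pi.smul_apply, smul_eq_mul]
    exact Finset.sum_congr rfl fun l _ => by ring
  refine ⟨hs, hpos, hhom, fun x y hy w hw => ?_⟩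
  have hp := hpos x y hy
  rw [sum_fundamentalTensor hs x hy]
  simp only [vertDeriv_vertDeriv_add_oneForm hα.smoothOffZero hb _ _ x hy]
  rcases hα.hessian_pos_or_radial x hy w with h | ⟨s, rfl⟩
  · positivity
  have h0 : ∑ i, ∑ j, vertDeriv i (vertDeriv j α) x y * (s • y) i * (s • y) j = 0 := by
    rw [← hα.sum_vertDeriv_vertDeriv_sub x hy _ s]
    simp
  have h1 : ∑ i, vertDeriv i (fun x y => α x y + oneForm b x y) x y * (s • y) i =
      s * (α x y + oneForm b x y) := by
    rw [← euler_one (hs.differentiableAt_vert x hy) (hhom x y), Finset.mul_sum]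
    refine Finset.sum_congr rfl fun i _ => ?_
    simp only [Pi.smul_apply, smul_eq_mul, vertDeriv]
    ring
  have hs0 : s ≠ 0 := fun h => hw (by simp [h])
  rw [h0, h1, mul_zero, add_zero]
  positivity

end IsFinslerMetric

/-- A Finsler metric obtained by adding a one-form to a reversible Douglas metric is a Douglas
metric if and only if the one-form is closed. -/
theorem IsDouglasMetric.add_oneForm_iff (hα : IsDouglasMetric α)
    (hrev : ∀ x y, α x (-y) = α x y) (hb : ∀ l, ContDiff ℝ ∞ (b l))
    (hpos : ∀ x y, y ≠ 0 → 0 < α x y + oneForm b x y) :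
    IsDouglasMetric (fun x y => α x y + oneForm b x y) ↔
      ∀ x k l, partialDeriv k (b l) x = partialDeriv l (b k) x := by
  have hαF := hα.finsler
  have hαs := hαF.smoothOffZero
  have hEL : ∀ x y, y ≠ 0 → ∀ l,
      (∑ k, horDeriv k (vertDeriv l (fun x y => α x y + oneForm b x y)) x y * y k)
        - horDeriv l (fun x y => α x y + oneForm b x y) x y =
      ((∑ k, horDeriv k (vertDeriv l α) x y * y k) - horDeriv l α x y)
        + ∑ k, (partialDeriv k (b l) x - partialDeriv l (b k) x) * y k := by
    intro x y hy l
    simp only [horDeriv_vertDeriv_add_oneForm hαs hb _ l x hy, horDeriv_add_oneForm hαs hb l x hy,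
      add_mul, sub_mul, Finset.sum_add_distrib, Finset.sum_sub_distrib]
    ring
  rw [(hαF.add_oneForm hb hpos).isDouglasMetric_iff]
  constructor
  · rintro ⟨Γ, h⟩ x k l
    -- Subtract the Douglas equations at `y` and `-y`: every term is even except the contribution of
    -- the one-form.
    have h0 : ∀ y : Fin n → ℝ, y ≠ 0 →
        ∑ k, (partialDeriv k (b l) x - partialDeriv l (b k) x) * y k = 0 := by
      intro y hy
      have hy' : -y ≠ 0 := neg_ne_zero.mpr hy
      have v1 : ∀ i p v, v ≠ 0 → vertDeriv i α p (-v) = -1 * vertDeriv i α p v :=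
        fun i p v hv => vertDeriv_neg i (hαs.differentiableAt_vert p (neg_ne_zero.mpr hv))
          (fun w => by rw [hrev, one_mul]) (one_mul 1)
      have v2 : ∀ i j, vertDeriv i (vertDeriv j α) x (-y) = vertDeriv i (vertDeriv j α) x y := by
        intro i j
        -- Oddness of the first derivative is known only off zero, so the second derivative is
        -- compared through an equality near `y`.
        have e : (fun v => vertDeriv j α x (-v)) =ᶠ[nhds y] fun v => -1 * vertDeriv j α x v := by
          filter_upwards [isOpen_ne.mem_nhds hy] with v hv using v1 j x v hv
        have hn : (-1 : ℝ) • y = -y := by simp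
        have hd := (hαs.vertDeriv j).differentiableAt_vert x hy'
        have e1 := partialDeriv_comp_smul i (vertDeriv j α x) (-1) (x := y) (by rwa [hn])
        simp only [neg_smul, one_smul] at e1
        rw [partialDeriv_congr e, partialDeriv_const_mul _
          ((hαs.vertDeriv j).differentiableAt_vert x hy)] at e1
        simp only [vertDeriv] at e1 ⊢
        linarith
      have v3 : ∀ k, horDeriv k (vertDeriv l α) x (-y) * (-y) k =
          horDeriv k (vertDeriv l α) x y * y k := by
        intro k
        simp only [horDeriv, v1 l _ y hy]
        rw [partialDeriv_const_mul _ ((hαs.vertDeriv l).differentiableAt_hor x hy), Pi.neg_apply]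
        ring
      have v4 : horDeriv l α x (-y) = horDeriv l α x y := by simp only [horDeriv, hrev]
      have p1 := h x y hy l
      have p2 := h x (-y) hy' l
      rw [hEL x _ hy l] at p1
      rw [hEL x _ hy' l, v4, Finset.sum_congr rfl fun k _ => v3 k] at p2
      simp only [vertDeriv_vertDeriv_add_oneForm hαs hb _ _ x hy] at p1
      simp only [vertDeriv_vertDeriv_add_oneForm hαs hb _ _ x hy', v2, Pi.neg_apply, mul_neg,
        neg_mul, neg_neg, Finset.sum_neg_distrib] at p2
      linarith
    have h1 := h0 (Pi.single k 1) (by simp)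
    simpa [Pi.single_apply, sub_eq_zero] using h1
  · intro hc
    obtain ⟨Γ, h⟩ := hαF.isDouglasMetric_iff.mp hα
    refine ⟨Γ, fun x y hy l => ?_⟩
    rw [hEL x y hy l, h x y hy l]
    simp only [vertDeriv_vertDeriv_add_oneForm hαs hb _ _ x hy, hc x _ l, sub_self, zero_mul,
      Finset.sum_const_zero, add_zero]

/-! ### Riemannian metrics -/

variable {a : (Fin n → ℝ) → Fin n → Fin n → ℝ}

/-- The norm of a Riemannian metric. -/
noncomputable def riemannianNorm (a : (Fin n → ℝ) → Fin n → Fin n → ℝ) (x y : Fin n → ℝ) : ℝ :=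
  Real.sqrt (∑ i, ∑ j, a x i j * y i * y j)

theorem riemannianNorm_sq (hpos : ∀ x y : Fin n → ℝ, y ≠ 0 → 0 < ∑ i, ∑ j, a x i j * y i * y j)
    (x y : Fin n → ℝ) : riemannianNorm a x y ^ 2 = ∑ i, ∑ j, a x i j * y i * y j := by
  rcases eq_or_ne y 0 with rfl | hy
  · simp [riemannianNorm]
  · exact Real.sq_sqrt (hpos x y hy).le

theorem riemannianNorm_neg (x y : Fin n → ℝ) : riemannianNorm a x (-y) = riemannianNorm a x y := by
  simp [riemannianNorm]

theorem partialDeriv_riemannianNorm_sq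
    (hpos : ∀ x y : Fin n → ℝ, y ≠ 0 → 0 < ∑ i, ∑ j, a x i j * y i * y j)
    (hsymm : ∀ x i j, a x i j = a x j i) (l : Fin n) (x y : Fin n → ℝ) :
    partialDeriv l (fun v => riemannianNorm a x v ^ 2) y = ∑ j, 2 * a x l j * y j := by
  simp only [riemannianNorm_sq hpos]
  rw [partialDeriv_sum _ fun i _ => by fun_prop]
  have h : ∀ i, partialDeriv l (fun v => ∑ j, a x i j * v i * v j) y =
      ∑ j, (a x i j * y i * (if l = j then 1 else 0) +
        a x i j * (if l = i then 1 else 0) * y j) := by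
    intro i
    rw [partialDeriv_sum _ fun j _ => by fun_prop]
    refine Finset.sum_congr rfl fun j _ => ?_
    rw [partialDeriv_mul (by fun_prop) (by fun_prop),
      partialDeriv_const_mul _ (differentiableAt_apply _ _), partialDeriv_apply,
      partialDeriv_apply]
  simp only [h, Finset.sum_add_distrib]
  have e1 : ∑ i, ∑ j, a x i j * y i * (if l = j then (1 : ℝ) else 0) = ∑ j, a x l j * y j := by
    simp [hsymm x l]
  have e2 : ∑ i, ∑ j, a x i j * (if l = i then (1 : ℝ) else 0) * y j = ∑ j, a x l j * y j := by
    rw [Finset.sum_comm]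
    simp
  rw [e1, e2, ← Finset.sum_add_distrib]
  exact Finset.sum_congr rfl fun j _ => by ring

theorem isFinslerMetric_riemannianNorm (ha : ∀ i j, ContDiff ℝ ∞ fun x => a x i j)
    (hpos : ∀ x y : Fin n → ℝ, y ≠ 0 → 0 < ∑ i, ∑ j, a x i j * y i * y j)
    (hsymm : ∀ x i j, a x i j = a x j i) : IsFinslerMetric (riemannianNorm a) := by
  refine ⟨?_, fun x y hy => Real.sqrt_pos.mpr (hpos x y hy), fun x y t ht => ?_,
    fun x y hy w hw => ?_⟩
  · refine ContDiffOn.sqrt (ContDiff.contDiffOn ?_) fun q hq => (hpos q.1 q.2 hq).ne'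
    refine ContDiff.sum fun i _ => ContDiff.sum fun j _ => ?_
    have := ha i j
    fun_prop
  · have h : ∑ i, ∑ j, a x i j * (t • y) i * (t • y) j =
        t ^ 2 * ∑ i, ∑ j, a x i j * y i * y j := by
      simp only [Finset.mul_sum, Pi.smul_apply, smul_eq_mul]
      exact Finset.sum_congr rfl fun j _ => Finset.sum_congr rfl fun k _ => by ring
    rw [riemannianNorm, h, Real.sqrt_mul (sq_nonneg t), Real.sqrt_sq ht.le, riemannianNorm]
  · have h : ∀ i j, fundamentalTensor (riemannianNorm a) x y i j = a x i j := fun i j => by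
      simp only [fundamentalTensor, Matrix.of_apply, partialDeriv_riemannianNorm_sq hpos hsymm,
        partialDeriv_linear]
      rw [hsymm x j i]
      ring
    simpa only [h] using hpos x w hw

/-- The fundamental tensor is `a`, independent of `y`, so the spray is already quadratic in `y` and
`P = 0` works. -/
theorem isDouglasMetric_riemannianNorm (ha : ∀ i j, ContDiff ℝ ∞ fun x => a x i j)
    (hpos : ∀ x y : Fin n → ℝ, y ≠ 0 → 0 < ∑ i, ∑ j, a x i j * y i * y j)
    (hsymm : ∀ x i j, a x i j = a x j i) : IsDouglasMetric (riemannianNorm a) := by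
  have hd : ∀ i j x, DifferentiableAt ℝ (fun x => a x i j) x := fun i j x =>
    ((ha i j).differentiable (by simp)).differentiableAt
  have ht : ∀ x y, fundamentalTensor (riemannianNorm a) x y = Matrix.of (a x) := fun x y => by
    ext i j
    simp only [fundamentalTensor, Matrix.of_apply, partialDeriv_riemannianNorm_sq hpos hsymm,
      partialDeriv_linear]
    rw [hsymm x j i]
    ring
  have h1 : ∀ k l x y, partialDeriv k
      (fun p => partialDeriv l (fun v => riemannianNorm a p v ^ 2) y) x =
      ∑ j, 2 * partialDeriv k (fun p => a p l j) x * y j := by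
    intro k l x y
    simp only [partialDeriv_riemannianNorm_sq hpos hsymm]
    rw [partialDeriv_sum _ fun j _ => ((hd l j x).const_mul 2).mul_const (y j)]
    refine Finset.sum_congr rfl fun j _ => ?_
    rw [partialDeriv_mul ((hd l j x).const_mul 2) (differentiableAt_const _), partialDeriv_const,
      partialDeriv_const_mul _ (hd l j x)]
    ring
  have h2 : ∀ l x y, partialDeriv l (fun p => riemannianNorm a p y ^ 2) x =
      ∑ j, ∑ k, partialDeriv l (fun p => a p j k) x * y j * y k := by
    intro l x y
    simp only [riemannianNorm_sq hpos]
    rw [partialDeriv_sum _ fun i _ => DifferentiableAt.fun_sum fun j _ =>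
      ((hd i j x).mul_const (y i)).mul_const (y j)]
    refine Finset.sum_congr rfl fun i _ => ?_
    rw [partialDeriv_sum _ fun j _ => ((hd i j x).mul_const (y i)).mul_const (y j)]
    refine Finset.sum_congr rfl fun j _ => ?_
    rw [partialDeriv_mul ((hd i j x).mul_const (y i)) (differentiableAt_const _),
      partialDeriv_mul (hd i j x) (differentiableAt_const _), partialDeriv_const,
      partialDeriv_const]
    ring
  -- These are not the symmetric Christoffel symbols, but they give the same quadratic form in `y`;
  -- the definition asks for no symmetry.
  refine ⟨isFinslerMetric_riemannianNorm ha hpos hsymm, fun x i j k =>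
    1 / 2 * ∑ l, (Matrix.of (a x))⁻¹ i l * (2 * partialDeriv k (fun p => a p l j) x
      - partialDeriv l (fun p => a p j k) x), fun _ _ => 0, by simp, fun x y _ i => ?_⟩
  have h3 : ∀ l, (∑ k, (∑ j, 2 * partialDeriv k (fun p => a p l j) x * y j) * y k)
      - ∑ j, ∑ k, partialDeriv l (fun p => a p j k) x * y j * y k =
      ∑ j, ∑ k, (2 * partialDeriv k (fun p => a p l j) x
        - partialDeriv l (fun p => a p j k) x) * y j * y k := by
    intro l
    simp only [sub_mul, Finset.sum_sub_distrib, Finset.sum_mul]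
    rw [Finset.sum_comm]
  simp only [sprayCoeff, ht, h1, h2, h3, zero_mul, add_zero]
  simp only [Finset.mul_sum, Finset.sum_mul]
  rw [Finset.sum_comm]
  refine Finset.sum_congr rfl fun j _ => ?_
  rw [Finset.sum_comm]
  exact Finset.sum_congr rfl fun k _ => Finset.sum_congr rfl fun l _ => by ring

end FinslerChart

namespace Heisenberg

/-! ### Left-invariant fields and one-forms on the Heisenberg group -/

theorem metric_eq_sum (p u v : Fin 3 → ℝ) :
    metric p u v = ∑ i, ∑ j, metric p (Pi.single i 1) (Pi.single j 1) * u i * v j := by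
  simp [metric, Fin.sum_univ_three, Pi.single_apply]
  ring

theorem metric_comm (p u v : Fin 3 → ℝ) : metric p u v = metric p v u := by
  simp only [metric]
  ring

theorem metric_self_pos (p : Fin 3 → ℝ) {v : Fin 3 → ℝ} (hv : v ≠ 0) : 0 < metric p v v := by
  contrapose! hv
  simp only [metric] at hv
  set s := v 2 + p 1 / 2 * v 0 - p 0 / 2 * v 1 with hs
  have e0 := mul_self_nonneg (v 0)
  have e1 := mul_self_nonneg (v 1)
  have e2 := mul_self_nonneg s
  have h0 : v 0 = 0 := by nlinarith
  have h1 : v 1 = 0 := by nlinarith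
  have h2 : s = 0 := by nlinarith
  have h3 : v 2 = 0 := by rw [h0, h1] at hs; linarith
  ext i
  fin_cases i
  exacts [h0, h1, h3]

/-- Cauchy–Schwarz by Lagrange's identity in the orthonormal coframe. -/
theorem metric_sq_le (p u v : Fin 3 → ℝ) :
    metric p u v ^ 2 ≤ metric p u u * metric p v v := by
  simp only [metric]
  set s := u 2 + p 1 / 2 * u 0 - p 0 / 2 * u 1
  set t := v 2 + p 1 / 2 * v 0 - p 0 / 2 * v 1
  linarith [sq_nonneg (u 0 * v 1 - u 1 * v 0), sq_nonneg (u 0 * t - s * v 0),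
    sq_nonneg (u 1 * t - s * v 1)]

/-- The field is the left translate of its value at the identity, the origin, so `X 0` lists its
constant components in the frame. -/
theorem IsLeftInvariant.apply_eq {X : (Fin 3 → ℝ) → (Fin 3 → ℝ)} (hX : IsLeftInvariant X)
    (p : Fin 3 → ℝ) :
    X p = ![X 0 0, X 0 1, X 0 2 + (1 / 2) * X 0 1 * p 0 - (1 / 2) * p 1 * X 0 0] := by
  have h : mul p 0 = p := by
    ext i
    fin_cases i <;> simp [mul]
  rw [← fderiv_mul p 0 (X 0), hX p 0, h]

theorem IsLeftInvariant.metric_eq {X : (Fin 3 → ℝ) → (Fin 3 → ℝ)} (hX : IsLeftInvariant X)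
    (p v : Fin 3 → ℝ) :
    metric p (X p) v =
      X 0 0 * v 0 + X 0 1 * v 1 + X 0 2 * (v 2 + p 1 / 2 * v 0 - p 0 / 2 * v 1) := by
  rw [hX.apply_eq p]
  simp only [metric, Matrix.cons_val]
  ring

theorem IsLeftInvariant.eq_frame_iff {X : (Fin 3 → ℝ) → (Fin 3 → ℝ)} (hX : IsLeftInvariant X)
    (a b : ℝ) : (∀ p, X p = a • frame 0 p + b • frame 1 p) ↔
      X 0 0 = a ∧ X 0 1 = b ∧ X 0 2 = 0 := by
  constructor
  · intro h
    rw [h 0]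
    simp [frame]
  · rintro ⟨rfl, rfl, h2⟩ p
    rw [hX.apply_eq p, h2]
    ext i
    fin_cases i <;> simp [frame]
    ring

/-- The coefficients of the one-form `c₀ dx + c₁ dy + c₂ (dz + (y/2) dx - (x/2) dy)`. -/
noncomputable def leftInvariantForm (c : Fin 3 → ℝ) : Fin 3 → (Fin 3 → ℝ) → ℝ :=
  ![fun p => c 0 + c 2 / 2 * p 1, fun p => c 1 - c 2 / 2 * p 0, fun _ => c 2]

theorem contDiff_leftInvariantForm (c : Fin 3 → ℝ) (l : Fin 3) :
    ContDiff ℝ ∞ (leftInvariantForm c l) := by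
  fin_cases l <;> simp [leftInvariantForm] <;> fun_prop

theorem partialDeriv_leftInvariantForm (c : Fin 3 → ℝ) (k l : Fin 3) (x : Fin 3 → ℝ) :
    partialDeriv k (leftInvariantForm c l) x =
      !![0, -(c 2 / 2), 0; c 2 / 2, 0, 0; 0, 0, 0] k l := by
  have h0 : partialDeriv k (leftInvariantForm c 0) x = c 2 / 2 * if k = 1 then 1 else 0 := by
    change partialDeriv k (fun p => c 0 + c 2 / 2 * p 1) x = _
    rw [partialDeriv_add (by fun_prop) (by fun_prop), partialDeriv_const, zero_add,
      partialDeriv_const_mul _ (differentiableAt_apply _ _), partialDeriv_apply]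
  have h1 : partialDeriv k (leftInvariantForm c 1) x = -(c 2 / 2) * if k = 0 then 1 else 0 := by
    have : leftInvariantForm c 1 = fun p => c 1 + -(c 2 / 2) * p 0 := by
      funext p
      simp only [leftInvariantForm, Matrix.cons_val_one, Matrix.cons_val_zero]
      ring
    rw [this, partialDeriv_add (by fun_prop) (by fun_prop), partialDeriv_const, zero_add,
      partialDeriv_const_mul _ (differentiableAt_apply _ _), partialDeriv_apply]
  have h2 : partialDeriv k (leftInvariantForm c 2) x = 0 := partialDeriv_const k (c 2) x
  fin_cases l
  · refine h0.trans ?_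
    fin_cases k <;> simp
  · refine h1.trans ?_
    fin_cases k <;> simp
  · refine h2.trans ?_
    fin_cases k <;> simp

/-- A conformal multiple of a left-invariant one-form is closed precisely when the form has no
`e₃`-component and satisfies the two first-order equations. -/
theorem closed_exp_mul_iff {c : Fin 3 → ℝ} (hc : c ≠ 0) {f : (Fin 3 → ℝ) → ℝ}
    (hf : Differentiable ℝ f) :
    (∀ x k l, partialDeriv k (fun p => Real.exp (f p) * leftInvariantForm c l p) x =
        partialDeriv l (fun p => Real.exp (f p) * leftInvariantForm c k p) x) ↔
      c 2 = 0 ∧ (∀ p, partialDeriv 2 f p = 0) ∧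
        ∀ p, c 1 * partialDeriv 0 f p - c 0 * partialDeriv 1 f p = 0 := by
  have hexp : ∀ k x, partialDeriv k (fun p => Real.exp (f p)) x =
      Real.exp (f x) * partialDeriv k f x := fun k x => by
    simp [partialDeriv, fderiv_exp (hf x)]
  have hd : ∀ k l x, partialDeriv k (fun p => Real.exp (f p) * leftInvariantForm c l p) x =
      Real.exp (f x) * (!![0, -(c 2 / 2), 0; c 2 / 2, 0, 0; 0, 0, 0] k l
        + partialDeriv k f x * leftInvariantForm c l x) := fun k l x => by
    rw [partialDeriv_mul (hf x).exp
      ((contDiff_leftInvariantForm c l).differentiable (by simp) x),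
      partialDeriv_leftInvariantForm, hexp]
    ring
  simp only [hd, mul_right_inj' (Real.exp_ne_zero _)]
  constructor
  · intro h
    have h01 := fun x => h x 0 1
    have h02 := fun x => h x 0 2
    have h12 := fun x => h x 1 2
    simp [leftInvariantForm] at h01 h02 h12
    have hc2 : c 2 = 0 := by
      -- This is `ω ∧ (df ∧ ω + dω) = ω ∧ dω` at the origin: the multipliers are, up to sign, the
      -- components of `ω` there, and the derivatives of `f` cancel.
      have e : c 2 * c 2 = 0 := by
        linear_combination (-c 2) * h01 0 + (c 1 - c 2 / 2 * (0 : Fin 3 → ℝ) 0) * h02 0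
          - (c 0 + c 2 / 2 * (0 : Fin 3 → ℝ) 1) * h12 0
      exact mul_self_eq_zero.mp e
    simp only [hc2, mul_zero, zero_div, neg_zero, zero_mul, add_zero, sub_zero, zero_add]
      at h01 h02 h12
    refine ⟨hc2, fun p => ?_, fun p => by linear_combination h01 p⟩
    -- With `c₂ = 0` the remaining equations read `c₀ ∂f/∂z = c₁ ∂f/∂z = 0`, so a nonzero `∂f/∂z`
    -- would force `c = 0`.
    by_contra hp
    refine hc (funext fun i => ?_)
    fin_cases i
    · exact (mul_eq_zero.mp (h02 p).symm).resolve_left hp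
    · exact (mul_eq_zero.mp (h12 p).symm).resolve_left hp
    · exact hc2
  · rintro ⟨h2, hz, h⟩ x k l
    have hx := h x
    have hzx := hz x
    fin_cases k <;> fin_cases l <;> simp [leftInvariantForm, h2, hzx] <;> linarith

end Heisenberg

/-! ### The conformally changed Randers metric -/

theorem proposition4p1
    (X : (Fin 3 → ℝ) → (Fin 3 → ℝ)) (hX : Heisenberg.IsLeftInvariant X)
    (hX_ne : X ≠ 0)
    (hX_lt : ∀ p, Heisenberg.metric p (X p) (X p) < 1)
    (f : (Fin 3 → ℝ) → ℝ) (hf : ContDiff ℝ ∞ f) :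
    IsDouglasMetric (conformal f (randers Heisenberg.metric X)) ↔
      ∃ a b : ℝ,
        (∀ p, X p = a • Heisenberg.frame 0 p + b • Heisenberg.frame 1 p) ∧
        (∀ p, partialDeriv 2 f p = 0) ∧
        (∀ p, b * partialDeriv 0 f p - a * partialDeriv 1 f p = 0) := by
  set A : (Fin 3 → ℝ) → Fin 3 → Fin 3 → ℝ := fun p i j =>
    Real.exp (f p) ^ 2 * Heisenberg.metric p (Pi.single i 1) (Pi.single j 1) with hA
  set B : Fin 3 → (Fin 3 → ℝ) → ℝ := fun l p =>
    Real.exp (f p) * Heisenberg.leftInvariantForm (X 0) l p with hB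
  have hAsum : ∀ x y : Fin 3 → ℝ, ∑ i, ∑ j, A x i j * y i * y j =
      Real.exp (f x) ^ 2 * Heisenberg.metric x y y := fun x y => by
    rw [Heisenberg.metric_eq_sum x y y]
    simp only [hA, Finset.mul_sum, mul_assoc]
  have hBsum : ∀ x y : Fin 3 → ℝ, oneForm B x y =
      Real.exp (f x) * Heisenberg.metric x (X x) y := fun x y => by
    rw [hX.metric_eq]
    simp [oneForm, hB, Fin.sum_univ_three, Heisenberg.leftInvariantForm]
    ring
  have hnorm : ∀ x y : Fin 3 → ℝ, riemannianNorm A x y =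
      Real.exp (f x) * Real.sqrt (Heisenberg.metric x y y) := fun x y => by
    rw [riemannianNorm, hAsum, Real.sqrt_mul (sq_nonneg _), Real.sqrt_sq (Real.exp_pos _).le]
  have hF : conformal f (randers Heisenberg.metric X) =
      fun x y => riemannianNorm A x y + oneForm B x y := by
    funext x y
    rw [hnorm, hBsum, conformal, randers, mul_add]
  have hAsmooth : ∀ i j, ContDiff ℝ ∞ fun p => A p i j := fun i j => by
    simp only [hA, Heisenberg.metric]
    fun_prop
  have hBsmooth : ∀ l, ContDiff ℝ ∞ (B l) := fun l =>
    (Real.contDiff_exp.comp hf).mul (Heisenberg.contDiff_leftInvariantForm (X 0) l)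
  have hApos : ∀ x y : Fin 3 → ℝ, y ≠ 0 → 0 < ∑ i, ∑ j, A x i j * y i * y j := fun x y hy => by
    rw [hAsum]
    have := Heisenberg.metric_self_pos x hy
    positivity
  have hAsymm : ∀ x i j, A x i j = A x j i := fun x i j => by
    simp only [hA]
    rw [Heisenberg.metric_comm]
  have hpos : ∀ x y : Fin 3 → ℝ, y ≠ 0 → 0 < riemannianNorm A x y + oneForm B x y := by
    intro x y hy
    rw [hnorm, hBsum, ← mul_add]
    refine mul_pos (Real.exp_pos _) ?_
    have h1 := Heisenberg.metric_self_pos x hy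
    -- Cauchy–Schwarz with `g(X, X) < 1` gives `|β| < α`, hence positivity of `α + β`.
    have h2 : Heisenberg.metric x (X x) y ^ 2 < Heisenberg.metric x y y :=
      (Heisenberg.metric_sq_le x (X x) y).trans_lt (by nlinarith [hX_lt x])
    have h3 := Real.neg_sqrt_lt_of_sq_lt h2
    linarith
  have hX0 : X 0 ≠ 0 := fun h => hX_ne (funext fun p => by
    rw [hX.apply_eq p, h]
    ext i
    fin_cases i <;> simp)
  rw [hF, (isDouglasMetric_riemannianNorm hAsmooth hApos hAsymm).add_oneForm_iff
    riemannianNorm_neg hBsmooth hpos,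
    Heisenberg.closed_exp_mul_iff hX0 (hf.differentiable (by simp))]
  simp only [hX.eq_frame_iff]
  constructor
  · rintro ⟨h2, hz, h⟩
    exact ⟨_, _, ⟨rfl, rfl, h2⟩, hz, h⟩
  · rintro ⟨a, b, ⟨rfl, rfl, h2⟩, hz, h⟩
    exact ⟨h2, hz, h⟩
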